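/- Let $f:\mathbb{R}^n\to(-\infty,+\infty]$ and $g:\mathbb{R}^m\to(-\infty,+\infty]$ be proper closed convex functions, $K\in\mathbb{R}^{m\times n}$, and let $g^*(y)=\sup_{z}\{\langle z,y\rangle-g(z)\}$ be the convex conjugate of $g$. Assume that the problem $$\min_{x\in\mathbb{R}^n}\max_{y\in\mathbb{R}^m}\ \mathcal{L}(x,y)=f(x)+\langle Kx,y\rangle-g^*(y)$$ has a saddle point, that is, there are $x^\star\in\mathrm{dom}\,f$ and $y^\star\in\mathrm{dom}\,g^*$ with $\mathcal{L}(x^\star,y)\le\mathcal{L}(x^\star,y^\star)\le\mathcal{L}(x,y^\star)$ for all $x,y$. Let $\Sigma_f$ be a symmetric positive semidefinite matrix such that $\langle\xi_1-\xi_2,x_1-x_2\rangle\ge\|x_1-x_2\|_{\Sigma_f}^2$ for all $x_1,x_2$ and all $\xi_1\in\partial f(x_1)$, $\xi_2\in\partial f(x_2)$, where $\|z\|_M^2:=\langle z,Mz\rangle$ for a symmetric (possibly indefinite) matrix $M$. Let $M_1\in\mathbb{R}^{n\times n}$ and $M_2\in\mathbb{R}^{m\times m}$ be symmetric matrices, and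 let $\{(x^k,y^k)\}_{k\ge0}$ be generated from an arbitrary $(x^0,y^0)\in\mathbb{R}^n\times\mathbb{R}^m$ by the preconditioned primal-dual hybrid gradient iteration (without stopping) $$x^{k+1}\in\operatorname*{argmin}_{x\in\mathbb{R}^n}\ f(x)+\langle Kx,y^k\rangle+\tfrac12\|x-x^k\|_{M_1}^2,$$ $$y^{k+1}\in\operatorname*{argmin}_{y\in\mathbb{R}^m}\ g^*(y)-\langle K(2x^{k+1}-x^k),y\rangle+\tfrac12\|y-y^k\|_{M_2}^2 .$$ Define the KKT residual $$\mathcal{R}(x,y)=\max\{\mathrm{dist}(0,\partial f(x)+K^{\mathsf T}y),\ \mathrm{dist}(0,\partial g^*(y)-Kx)\}\in[0,+\infty],$$ where $\mathrm{dist}$ is the Euclidean distance and the distance to the empty set is $+\infty$ (so $\mathcal{R}(x^1,y^0)$ may be $+\infty$). Below $\|\cdot\|$ of a matrix is the spectral norm, $M^{-1/2}$ is the positive semidefinite square root of $M^{-1}$, and $o(1/\sqrt t)$ refers to $t\to\infty$. (i) If $M_1+\tfrac12\Sigma_f\succ0$, $M_2\succ0$ and $\big\|M_2^{-1/2}K(M_1+\tfrac12\Sigma_f)^{-1/2}\big\|^2<\tfrac43$,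 then $$\min_{1\le k\le t}\mathcal{R}(x^k,y^k)=o\!\left(\tfrac1{\sqrt t}\right)\quad\text{and}\quad\min_{1\le k\le t}\mathcal{R}(x^k,y^{k-1})=o\!\left(\tfrac1{\sqrt t}\right).$$ (ii) If $M_1+\tfrac12\Sigma_f\succ0$, $M_2\succ0$ and $\big\|M_2^{-1/2}K(M_1+\tfrac12\Sigma_f)^{-1/2}\big\|<1$, then $$\mathcal{R}(x^t,y^t)=o\!\left(\tfrac1{\sqrt t}\right)\quad\text{and}\quad\mathcal{R}(x^t,y^{t-1})=o\!\left(\tfrac1{\sqrt t}\right).$$ -/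

import Mathlib

open Filter Topology
open scoped ENNReal InnerProductSpace

namespace PrePDHG

noncomputable section

/-- Euclidean space `ℝⁿ` with the `ℓ₂` norm and the standard inner product. -/
abbrev E (n : ℕ) : Type := EuclideanSpace ℝ (Fin n)

/-- `K x` for a real matrix `K` and a vector `x` of Euclidean space. -/
def mulVec {m n : ℕ} (K : Matrix (Fin m) (Fin n) ℝ) (x : E n) : E m :=
  WithLp.toLp 2 (Matrix.mulVec K (WithLp.ofLp x))

/-- The quadratic form `‖z‖²_M = ⟨z, M z⟩`; `M` need not be positive semidefinite. -/
def quad {n : ℕ} (M : Matrix (Fin n) (Fin n) ℝ) (z : E n) : ℝ := ⟪z, mulVec M z⟫_ℝ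

/-- A proper closed convex function `ℝⁿ → (-∞, +∞]`: it never takes the value `-∞`, is finite
somewhere, is lower semicontinuous and has a convex epigraph. -/
structure ProperClosedConvex {n : ℕ} (f : E n → EReal) : Prop where
  ne_bot : ∀ x, f x ≠ ⊥
  exists_ne_top : ∃ x, f x ≠ ⊤
  lowerSemicontinuous : LowerSemicontinuous f
  convex_epigraph : Convex ℝ {p : E n × ℝ | f p.1 ≤ (p.2 : EReal)}

/-- The convex conjugate `g*(y) = sup_z (⟨z, y⟩ - g z)`. -/
def conj {m : ℕ} (g : E m → EReal) (y : E m) : EReal :=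
  ⨆ z : E m, ((⟪z, y⟫_ℝ : ℝ) : EReal) - g z

/-- The subdifferential of `f` at `x`; it is empty outside the domain of `f`. -/
def subdiff {n : ℕ} (f : E n → EReal) (x : E n) : Set (E n) :=
  {ξ | f x < ⊤ ∧ ∀ z, f x + ((⟪ξ, z - x⟫_ℝ : ℝ) : EReal) ≤ f z}

/-- `S` is a symmetric positive semidefinite matrix with
`⟨ξ₁ - ξ₂, x₁ - x₂⟩ ≥ ‖x₁ - x₂‖²_S` for all `ξᵢ ∈ ∂f(xᵢ)`. -/
def IsMonotonicityModulus {n : ℕ} (f : E n → EReal) (S : Matrix (Fin n) (Fin n) ℝ) : Prop :=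
  S.PosSemidef ∧ ∀ x₁ x₂ ξ₁ ξ₂ : E n, ξ₁ ∈ subdiff f x₁ → ξ₂ ∈ subdiff f x₂ →
    quad S (x₁ - x₂) ≤ ⟪ξ₁ - ξ₂, x₁ - x₂⟫_ℝ

/-- The saddle function `L(x, y) = f(x) + ⟨K x, y⟩ - g*(y)`. -/
def saddleFun {m n : ℕ} (f : E n → EReal) (g : E m → EReal) (K : Matrix (Fin m) (Fin n) ℝ)
    (x : E n) (y : E m) : EReal :=
  f x + ((⟪mulVec K x, y⟫_ℝ : ℝ) : EReal) - conj g y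

/-- `(xs, ys)` is a saddle point of `min_x max_y L(x, y)`, with both components in the domains
of `f` and `g*`, so that the value of the saddle function there is finite. -/
def IsSaddlePoint {m n : ℕ} (f : E n → EReal) (g : E m → EReal) (K : Matrix (Fin m) (Fin n) ℝ)
    (xs : E n) (ys : E m) : Prop :=
  f xs < ⊤ ∧ conj g ys < ⊤ ∧
    ∀ (x : E n) (y : E m), saddleFun f g K xs y ≤ saddleFun f g K xs ys ∧
      saddleFun f g K xs ys ≤ saddleFun f g K x ys

/-- The set of global minimizers of `F`. -/
def argmin {n : ℕ} (F : E n → EReal) : Set (E n) := {x | ∀ z, F x ≤ F z}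

/-- `(x⁺, y⁺)` is produced from `(x, y)` by one iteration of the preconditioned primal-dual hybrid
gradient method. -/
def Step {m n : ℕ} (f : E n → EReal) (g : E m → EReal) (K : Matrix (Fin m) (Fin n) ℝ)
    (M₁ : Matrix (Fin n) (Fin n) ℝ) (M₂ : Matrix (Fin m) (Fin m) ℝ)
    (x : E n) (y : E m) (x' : E n) (y' : E m) : Prop :=
  x' ∈ argmin (fun z : E n =>
      f z + ((⟪mulVec K z, y⟫_ℝ + (1 / 2 : ℝ) * quad M₁ (z - x) : ℝ) : EReal)) ∧
  y' ∈ argmin (fun w : E m =>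
      conj g w + ((-⟪mulVec K ((2 : ℝ) • x' - x), w⟫_ℝ
        + (1 / 2 : ℝ) * quad M₂ (w - y) : ℝ) : EReal))

/-- `(x^k, y^k)` is a sequence of iterates of the method, from the arbitrary starting point
`(x^0, y^0)`. -/
def IsIterates {m n : ℕ} (f : E n → EReal) (g : E m → EReal) (K : Matrix (Fin m) (Fin n) ℝ)
    (M₁ : Matrix (Fin n) (Fin n) ℝ) (M₂ : Matrix (Fin m) (Fin m) ℝ)
    (x : ℕ → E n) (y : ℕ → E m) : Prop :=
  ∀ k, Step f g K M₁ M₂ (x k) (y k) (x (k + 1)) (y (k + 1))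

/-- The KKT residual
`R(x, y) = max {dist(0, ∂f(x) + Kᵀ y), dist(0, ∂g*(y) - K x)}`,
with values in `[0, ∞]`: the distance to the empty set is `∞`. -/
def kktResidual {m n : ℕ} (f : E n → EReal) (g : E m → EReal) (K : Matrix (Fin m) (Fin n) ℝ)
    (x : E n) (y : E m) : ℝ≥0∞ :=
  max (Metric.infEDist 0 ((fun ξ => ξ + mulVec K.transpose y) '' subdiff f x))
    (Metric.infEDist 0 ((fun η => η - mulVec K x) '' subdiff (conj g) y))

open scoped MatrixOrder Matrix.Norms.L2Operator in
/-- `M^{-1/2}`, the positive semidefinite square root of `M⁻¹`, for `M` positive definite. -/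
def invSqrt {n : ℕ} (M : Matrix (Fin n) (Fin n) ℝ) : Matrix (Fin n) (Fin n) ℝ :=
  CFC.sqrt M⁻¹

open scoped Matrix.Norms.L2Operator in
/-- The spectral norm of a matrix, that is, its operator norm for the `ℓ₂` norms. -/
def spectralNorm {m n : ℕ} (A : Matrix (Fin m) (Fin n) ℝ) : ℝ := ‖A‖

/-- `a t = o(1/√t)` as `t → ∞`, for a sequence in `[0, ∞]`: for every `ε > 0`, eventually
`a t ≤ ε / √t`. -/
def IsLittleOInvSqrt (a : ℕ → ℝ≥0∞) : Prop :=
  ∀ ε : ℝ, 0 < ε → ∀ᶠ t : ℕ in atTop, a t ≤ ENNReal.ofReal (ε / Real.sqrt t)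

end

end PrePDHG

/-! Put J = M₂⁻¹K, so that ⟨w, Kx⟩ is the M₂-inner product of w and Jx. Each step supplies explicit
subgradients of f and g*. Monotonicity of ∂f and ∂g* against the saddle point, plus monotonicity of
∂f between consecutive iterates, yields an energy that decreases along the iteration
(`energy_step`). It combines ‖x⁺ - x⋆‖² in M₁ + Σ_f, ‖y - y⋆ + J(x⁺ - x)‖² in M₂, and a correction
in the last primal increment. The decrease controls the primal increment as soon as ‖Ju‖²_{M₂} ≤
q‖u‖² in the norm of M₁ + Σ_f/2 with q < 4/3, so all increments are square-summable
(`summable_increments`).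

The chosen subgradients differ from zeros of the KKT system only by matrix images of increments
(`exists_kktResidual_le_increments`), so the squared residuals are summable. A running minimum is
monotone, and a monotone summable sequence is o(1/t): this is (i).

For (ii), if q < 1 the block form with diagonal M₁ + Σ_f, M₂ and off-diagonal -K is coercive
(`block_coercive`), and the increments measured in it never increase (`increment_antitone`).
Monotone and summable again give o(1/t), now without the minimum. -/

namespace PrePDHG

/-! ### Energy estimates for abstract bilinear forms -/

section Energy

variable {V W : Type*} [AddCommGroup V] [Module ℝ V] [AddCommGroup W] [Module ℝ W]

/-- One step of the energy estimate: the weighted sum of the monotonicity inequalities against the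
saddle point and between two consecutive iterates. Here `v = x⁺ - x⋆`, `d = x⁺ - x`,
`e = x - x⁻`, `w = y - y⋆` and `p = y - y⁻`. -/
theorem energy_step (a s : LinearMap.BilinForm ℝ V) (b : LinearMap.BilinForm ℝ W) (J : V →ₗ[ℝ] W)
    (ha : ∀ u v, a u v = a v u) (hb : ∀ u v, b u v = b v u)
    (hs0 : ∀ u, 0 ≤ s u u) (hb0 : ∀ u, 0 ≤ b u u)
    (hq : ∀ u, 3 / 4 * b (J u) (J u) ≤ a u u + 1 / 2 * s u u)
    (v d e : V) (w p : W)
    (h1 : s v v ≤ - b (J v) w - a v d)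
    (h2 : 0 ≤ b w (J (v - d + e) - p))
    (h3 : s d d ≤ - b (J d) p - a d (d - e)) :
    (a v v + s v v + b (w + J d) (w + J d)
        + 1 / 2 * (s d d + a d d - 1 / 2 * b (J d) (J d)))
      + (a d d + 1 / 2 * s d d - 3 / 4 * b (J d) (J d))
      + b (p + J d - J e - (1 / 2 : ℝ) • J d) (p + J d - J e - (1 / 2 : ℝ) • J d)
    ≤ a (v - d) (v - d) + s (v - d) (v - d) + b (w - p + J e) (w - p + J e)
        + 1 / 2 * (s e e + a e e - 1 / 2 * b (J e) (J e)) := by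
  -- Weights 2, 2, 1 on `h1`, `h2`, `h3` leave the slack 1/2 `h4` + 1/4 `h5` + 1/2 `h6` + 1/8 `h7`.
  -- The constant 3/4 is what turns the leftover terms in Jd and Je into the square 1/8 ‖Jd + Je‖².
  have h4 := hq (d - e)
  have h5 := hs0 (d + e)
  have h6 := hs0 (v + (v - d))
  have h7 := hb0 (J d + J e)
  simp only [map_add, map_sub, map_smul, LinearMap.add_apply, LinearMap.sub_apply,
    LinearMap.smul_apply, smul_eq_mul] at h1 h2 h3 h4 h5 h6 h7 ⊢
  linarith [ha d v, ha e d, hb p w, hb (J v) w, hb (J d) w, hb (J e) w,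
    hb (J d) p, hb (J e) p, hb (J e) (J d)]

/-- The increments of the iteration, measured in the norm of the preconditioner augmented by the
monotonicity modulus, do not increase. Here `d = x⁺⁺ - x⁺`, `e = x⁺ - x`, `r = y⁺⁺ - y⁺` and
`p = y⁺ - y`. -/
theorem increment_antitone (a s : LinearMap.BilinForm ℝ V) (b : LinearMap.BilinForm ℝ W)
    (J : V →ₗ[ℝ] W) (ha : ∀ u v, a u v = a v u)
    (hb : ∀ u v, b u v = b v u) (hs0 : ∀ u, 0 ≤ s u u)
    (hP : ∀ u r, 0 ≤ a u u + 1 / 2 * s u u - 2 * b (J u) r + b r r)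
    (d e : V) (r p : W)
    (h1 : s d d ≤ - b (J d) p - a d (d - e))
    (h2 : 0 ≤ b r (J (d + d - e) - (r - p))) :
    a d d + s d d - 2 * b (J d) r + b r r ≤ a e e + s e e - 2 * b (J e) p + b p p := by
  -- Both inequalities get weight 2. Splitting s(d,d) + s(e,e) into halves of s at d - e and d + e
  -- is why positivity with s/2 suffices in `hP`.
  have h4 := hP (d - e) (r - p)
  have h5 := hs0 (d + e)
  simp only [map_add, map_sub, LinearMap.add_apply, LinearMap.sub_apply] at h1 h2 h4 h5 ⊢
  linarith [ha e d, hb p r, hb (J d) r, hb (J e) r, hb (J d) p, hb (J e) p]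

/-- A form dominated with a constant below one yields a coercive block form. -/
theorem block_coercive (A : LinearMap.BilinForm ℝ V) (b : LinearMap.BilinForm ℝ W)
    (J : V →ₗ[ℝ] W) (hb : ∀ u v, b u v = b v u) (hb0 : ∀ u, 0 ≤ b u u)
    {q : ℝ} (hq0 : 0 ≤ q) (hq : ∀ u, b (J u) (J u) ≤ q * A u u) (hA : ∀ u, 0 ≤ A u u)
    (u : V) (r : W) :
    (1 - q) / 2 * (A u u + b r r) ≤ A u u - 2 * b (J u) r + b r r := by
  -- Young's inequality with parameter τ, the midpoint of q and 1: q ≤ τ² by AM-GM, so both diagonal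
  -- terms keep the factor 1 - τ.
  set τ := (1 + q) / 2 with hτ
  have hτ0 : 0 < τ := by linarith
  have h1 := hb0 (J u - τ • r)
  simp only [map_sub, map_smul, LinearMap.sub_apply, LinearMap.smul_apply, smul_eq_mul] at h1
  rw [hb r (J u)] at h1
  have h2 : 2 * b (J u) r ≤ q / τ * A u u + τ * b r r := by
    have : 2 * b (J u) r * τ ≤ q * A u u + τ * b r r * τ := by linarith [hq u]
    calc 2 * b (J u) r = 2 * b (J u) r * τ / τ := by field_simp
      _ ≤ (q * A u u + τ * b r r * τ) / τ := by gcongr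
      _ = _ := by field_simp
  have h3 : q / τ ≤ τ := by
    rw [div_le_iff₀ hτ0, hτ]; nlinarith [sq_nonneg (1 - q)]
  have h4 : (1 - q) / 2 = 1 - τ := by rw [hτ]; ring
  rw [h4]
  nlinarith [mul_le_mul_of_nonneg_right h3 (hA u)]

/-- Square-summability of the increments, from the energy estimate. -/
theorem summable_increments (a s : LinearMap.BilinForm ℝ V) (b : LinearMap.BilinForm ℝ W)
    (J : V →ₗ[ℝ] W) (ha : ∀ u v, a u v = a v u)
    (hb : ∀ u v, b u v = b v u) (hs0 : ∀ u, 0 ≤ s u u) (hb0 : ∀ u, 0 ≤ b u u)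
    (hA : ∀ u, 0 ≤ a u u + 1 / 2 * s u u)
    {q : ℝ} (hq1 : q < 4 / 3)
    (hq : ∀ u, b (J u) (J u) ≤ q * (a u u + 1 / 2 * s u u))
    (x : ℕ → V) (y : ℕ → W) (xs : V) (ys : W)
    (h1 : ∀ k, s (x (k + 1) - xs) (x (k + 1) - xs) ≤
      - b (J (x (k + 1) - xs)) (y k - ys) - a (x (k + 1) - xs) (x (k + 1) - x k))
    (h2 : ∀ k, 0 ≤ b (y (k + 1) - ys)
      (J (x (k + 1) + x (k + 1) - x k - xs) - (y (k + 1) - y k)))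
    (h3 : ∀ k, s (x (k + 2) - x (k + 1)) (x (k + 2) - x (k + 1)) ≤
      - b (J (x (k + 2) - x (k + 1))) (y (k + 1) - y k)
        - a (x (k + 2) - x (k + 1)) (x (k + 2) - x (k + 1) - (x (k + 1) - x k))) :
    Summable (fun k => a (x (k + 1) - x k) (x (k + 1) - x k)
        + 1 / 2 * s (x (k + 1) - x k) (x (k + 1) - x k)) ∧
      Summable (fun k => b (y (k + 1) - y k) (y (k + 1) - y k)) := by
  have hq34 : ∀ u, 3 / 4 * b (J u) (J u) ≤ a u u + 1 / 2 * s u u := fun u => by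
    nlinarith [hq u, hA u]
  set d : ℕ → V := fun k => x (k + 1) - x k with hd
  set z : ℕ → W := fun k => y (k + 1) - y k + J (d (k + 1)) - J (d k)
    - (1 / 2 : ℝ) • J (d (k + 1)) with hz
  set En : ℕ → ℝ := fun k => a (x (k + 1) - xs) (x (k + 1) - xs)
    + s (x (k + 1) - xs) (x (k + 1) - xs) + b (y k - ys + J (d k)) (y k - ys + J (d k))
    + 1 / 2 * (s (d k) (d k) + a (d k) (d k) - 1 / 2 * b (J (d k)) (J (d k))) with hEn
  set G : ℕ → ℝ := fun k => (a (d (k + 1)) (d (k + 1)) + 1 / 2 * s (d (k + 1)) (d (k + 1))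
    - 3 / 4 * b (J (d (k + 1))) (J (d (k + 1)))) + b (z k) (z k) with hG
  have hstep : ∀ k, En (k + 1) + G k ≤ En k := by
    intro k
    have := energy_step a s b J ha hb hs0 hb0 hq34 (x (k + 2) - xs) (d (k + 1)) (d k)
      (y (k + 1) - ys) (y (k + 1) - y k) (h1 (k + 1))
      (by convert h2 k using 4; simp only [hd]; abel) (h3 k)
    have e1 : x (k + 2) - xs - d (k + 1) = x (k + 1) - xs := by simp only [hd]; abel
    have e2 : y (k + 1) - ys - (y (k + 1) - y k) = y k - ys := by abel
    rw [e1, e2] at this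
    simp only [hEn, hG, hz]
    linarith
  have hEn0 : ∀ k, 0 ≤ En k := fun k => by
    have := hA (x (k + 1) - xs)
    have := hs0 (x (k + 1) - xs)
    have := hb0 (y k - ys + J (d k))
    have := hs0 (d k)
    have := hq34 (d k)
    have := hb0 (J (d k))
    simp only [hEn]; linarith
  have hc : (0 : ℝ) < 1 - 3 / 4 * q := by linarith
  have hG1 : ∀ k, (1 - 3 / 4 * q) * (a (d (k + 1)) (d (k + 1))
      + 1 / 2 * s (d (k + 1)) (d (k + 1))) ≤ G k := fun k => by
    have := hq (d (k + 1)); have := hb0 (z k); simp only [hG]; linarith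
  have hG2 : ∀ k, b (z k) (z k) ≤ G k := fun k => by
    have := hq34 (d (k + 1)); simp only [hG]; linarith
  have hG0 : ∀ k, 0 ≤ G k := fun k => (hb0 _).trans (hG2 k)
  have hGs : Summable G := by
    refine summable_of_sum_range_le (c := En 0) hG0 fun N => ?_
    have : ∀ N, ∑ k ∈ Finset.range N, G k ≤ En 0 - En N := fun N => by
      induction N with
      | zero => simp
      | succ N ih => rw [Finset.sum_range_succ]; linarith [hstep N]
    linarith [this N, hEn0 N]
  have hD : Summable (fun k => a (d k) (d k) + 1 / 2 * s (d k) (d k)) := by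
    rw [← summable_nat_add_iff 1, ← summable_mul_left_iff hc.ne']
    exact Summable.of_nonneg_of_le (fun k => mul_nonneg hc.le (hA _)) hG1 hGs
  refine ⟨hD, ?_⟩
  have hD' := (summable_nat_add_iff 1).2 hD
  refine Summable.of_nonneg_of_le (fun k => hb0 _) (fun k => ?_)
    ((hGs.mul_left 3).add ((hD'.mul_left (3 * q)).add (hD.mul_left (3 * q))))
  -- The dual increment is recovered from the dissipated square z; the square of a sum of three
  -- terms is at most three times the sum of the squares.
  have e : y (k + 1) - y k = z k - (1 / 2 : ℝ) • J (d (k + 1)) + J (d k) := by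
    simp only [hz]; module
  have k1 := hb0 (z k + (1 / 2 : ℝ) • J (d (k + 1)))
  have k2 := hb0 (z k - J (d k))
  have k3 := hb0 ((1 / 2 : ℝ) • J (d (k + 1)) + J (d k))
  have k4 := hq (d (k + 1))
  have k5 := hq (d k)
  have k6 := hG2 k
  have k7 := hb0 (J (d (k + 1)))
  rw [e]
  simp only [map_add, map_sub, map_smul, LinearMap.add_apply, LinearMap.sub_apply,
    LinearMap.smul_apply, smul_eq_mul] at k1 k2 k3 ⊢
  linarith [hb (J (d (k + 1))) (z k), hb (J (d k)) (z k), hb (J (d k)) (J (d (k + 1)))]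

end Energy

/-! ### From summability to o(1/√t) -/

section Rates

/-- A summable antitone sequence of nonnegative terms is `o(1/t)`, even after a shift. -/
theorem isLittleOInvSqrt_of_antitone {r : ℕ → ℝ} (hr : Antitone r) (hr0 : ∀ k, 0 ≤ r k)
    (hrs : Summable r) {a : ℕ → ℝ≥0∞} (N : ℕ)
    (ha : ∀ t, a (t + N) ≤ ENNReal.ofReal (Real.sqrt (r t))) : IsLittleOInvSqrt a := by
  intro ε hε
  have hcau := hrs.hasSum.tendsto_sum_nat.cauchySeq
  obtain ⟨N₁, hN₁⟩ := Metric.cauchySeq_iff.1 hcau (ε ^ 2 / 4) (by positivity)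
  filter_upwards [eventually_ge_atTop (4 * (N + N₁) + 4)] with t ht
  obtain ⟨u, rfl⟩ : ∃ u, t = u + N := ⟨t - N, by omega⟩
  -- By monotonicity r u is at most every term of the tail block, whose sum is below ε²/4; for large
  -- t the block has at least t/4 terms, hence t * r u ≤ ε².
  have hsum : ((u + 1 - N₁ : ℕ) : ℝ) * r u ≤ ∑ k ∈ Finset.Ico N₁ (u + 1), r k := by
    have := Finset.card_nsmul_le_sum (Finset.Ico N₁ (u + 1)) r (r u)
      (fun k hk => hr (by have := Finset.mem_Ico.1 hk; omega))
    simpa using this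
  have hd := hN₁ (u + 1) (by omega) N₁ le_rfl
  rw [Real.dist_eq, ← Finset.sum_Ico_eq_sub _ (by omega : N₁ ≤ u + 1)] at hd
  have hd' := (le_abs_self _).trans_lt hd
  have hcast : ((u + N : ℕ) : ℝ) ≤ 4 * ((u + 1 - N₁ : ℕ) : ℝ) := by
    exact_mod_cast (by omega : u + N ≤ 4 * (u + 1 - N₁))
  have hpos : (0 : ℝ) < ((u + N : ℕ) : ℝ) := by exact_mod_cast (by omega : 0 < u + N)
  refine (ha u).trans (ENNReal.ofReal_le_ofReal ?_)
  rw [Real.sqrt_le_left (by positivity), div_pow, Real.sq_sqrt hpos.le, le_div_iff₀ hpos]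
  nlinarith [mul_le_mul_of_nonneg_right hcast (hr0 u)]

/-- The running minimum of a square-summable sequence is `o(1/√t)`. -/
theorem isLittleOInvSqrt_iInf {r : ℕ → ℝ} (hr0 : ∀ k, 0 ≤ r k) (hrs : Summable r)
    {a : ℕ → ℝ≥0∞} {N : ℕ} (hN : 1 ≤ N)
    (ha : ∀ t, a (t + N) ≤ ENNReal.ofReal (Real.sqrt (r t))) :
    IsLittleOInvSqrt (fun t => ⨅ k ∈ Finset.Icc 1 t, a k) := by
  set m : ℕ → ℝ := fun t => (Finset.range (t + 1)).inf' Finset.nonempty_range_add_one r with hm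
  have hmem : ∀ t, ∃ k ≤ t, m t = r k := fun t => by
    obtain ⟨k, hk, h⟩ := Finset.exists_mem_eq_inf' (Finset.nonempty_range_add_one (n := t)) r
    exact ⟨k, by have := Finset.mem_range.1 hk; omega, h⟩
  have hm0 : ∀ t, 0 ≤ m t := fun t => by obtain ⟨k, -, h⟩ := hmem t; rw [h]; exact hr0 k
  have hmanti : Antitone m := fun s t hst =>
    Finset.inf'_mono r (Finset.range_mono (by omega)) _
  refine isLittleOInvSqrt_of_antitone hmanti hm0
    (hrs.of_nonneg_of_le hm0 fun t => Finset.inf'_le r (by simp)) N fun t => ?_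
  obtain ⟨k, hk, h⟩ := hmem t
  rw [h]
  exact (iInf₂_le (k + N) (Finset.mem_Icc.2 ⟨by omega, by omega⟩)).trans (ha k)

end Rates
-- Matrices as bilinear forms and weighted norms
section Forms

variable {m n : ℕ}

theorem mulVec_add (K : Matrix (Fin m) (Fin n) ℝ) (u v : E n) :
    mulVec K (u + v) = mulVec K u + mulVec K v := by
  simp [mulVec, Matrix.mulVec_add]

theorem mulVec_sub (K : Matrix (Fin m) (Fin n) ℝ) (u v : E n) :
    mulVec K (u - v) = mulVec K u - mulVec K v := by
  simp [mulVec, Matrix.mulVec_sub]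

theorem mulVec_smul (K : Matrix (Fin m) (Fin n) ℝ) (c : ℝ) (u : E n) :
    mulVec K (c • u) = c • mulVec K u := by
  simp [mulVec, Matrix.mulVec_smul]

theorem mulVec_mul {l : ℕ} (K : Matrix (Fin m) (Fin n) ℝ) (L : Matrix (Fin n) (Fin l) ℝ)
    (u : E l) : mulVec (K * L) u = mulVec K (mulVec L u) := by
  simp [mulVec, Matrix.mulVec_mulVec]

theorem mulVec_one (u : E n) : mulVec 1 u = u := by simp [mulVec]

theorem inner_mulVec (K : Matrix (Fin m) (Fin n) ℝ) (u : E n) (w : E m) :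
    ⟪mulVec K u, w⟫_ℝ = ⟪u, mulVec K.transpose w⟫_ℝ := by
  simp only [mulVec, EuclideanSpace.inner_eq_star_dotProduct, star_trivial]
  rw [Matrix.dotProduct_mulVec, Matrix.mulVec_transpose]

open scoped Matrix.Norms.L2Operator in
theorem norm_mulVec_le (K : Matrix (Fin m) (Fin n) ℝ) (u : E n) :
    ‖mulVec K u‖ ≤ spectralNorm K * ‖u‖ :=
  Matrix.l2_opNorm_mulVec K u

open scoped Matrix.Norms.L2Operator in
theorem spectralNorm_nonneg (K : Matrix (Fin m) (Fin n) ℝ) : 0 ≤ spectralNorm K :=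
  norm_nonneg K

/-- Multiplication by a matrix as a linear map of Euclidean spaces. -/
def mulVecLin (K : Matrix (Fin m) (Fin n) ℝ) : E n →ₗ[ℝ] E m where
  toFun := mulVec K
  map_add' := mulVec_add K
  map_smul' := mulVec_smul K

/-- The bilinear form `⟨u, M v⟩`. -/
noncomputable def bil (M : Matrix (Fin n) (Fin n) ℝ) : LinearMap.BilinForm ℝ (E n) :=
  (innerₗ (E n)).compl₂ (mulVecLin M)

theorem bil_apply (M : Matrix (Fin n) (Fin n) ℝ) (u v : E n) : bil M u v = ⟪u, mulVec M v⟫_ℝ :=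
  rfl

theorem bil_self (M : Matrix (Fin n) (Fin n) ℝ) (u : E n) : bil M u u = quad M u := rfl

theorem bil_comm {M : Matrix (Fin n) (Fin n) ℝ} (hM : M.IsSymm) (u v : E n) :
    bil M u v = bil M v u := by
  rw [bil_apply, bil_apply, ← real_inner_comm, inner_mulVec, hM.eq]

theorem quad_nonneg {M : Matrix (Fin n) (Fin n) ℝ} (hM : M.PosSemidef) (u : E n) :
    0 ≤ quad M u := by
  have := hM.dotProduct_mulVec_nonneg (WithLp.ofLp u)
  simpa [quad, mulVec, EuclideanSpace.inner_eq_star_dotProduct, dotProduct_comm] using this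

theorem quad_le (M : Matrix (Fin n) (Fin n) ℝ) (u : E n) :
    quad M u ≤ spectralNorm M * ‖u‖ ^ 2 := by
  have h1 := real_inner_le_norm u (mulVec M u)
  have h2 := mul_le_mul_of_nonneg_left (norm_mulVec_le M u) (norm_nonneg u)
  rw [quad]; nlinarith

theorem quad_add_half_smul (M S : Matrix (Fin n) (Fin n) ℝ) (u : E n) :
    quad (M + (1 / 2 : ℝ) • S) u = quad M u + 1 / 2 * quad S u := by
  have : mulVec (M + (1 / 2 : ℝ) • S) u = mulVec M u + (1 / 2 : ℝ) • mulVec S u := by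
    simp [mulVec, Matrix.add_mulVec, Matrix.smul_mulVec]
  rw [quad, this, inner_add_right, inner_smul_right]; rfl

theorem invSqrt_isSymm (M : Matrix (Fin n) (Fin n) ℝ) : (invSqrt M).IsSymm := by
  open scoped MatrixOrder Matrix.Norms.L2Operator in
  have h : 0 ≤ CFC.sqrt M⁻¹ := CFC.sqrt_nonneg _
  have h2 := (Matrix.nonneg_iff_posSemidef.1 h).isHermitian
  simpa [Matrix.IsHermitian, Matrix.IsSymm, invSqrt] using h2

theorem invSqrt_mul_self {M : Matrix (Fin n) (Fin n) ℝ} (hM : M.PosDef) :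
    invSqrt M * invSqrt M = M⁻¹ := by
  open scoped MatrixOrder Matrix.Norms.L2Operator in
  exact CFC.sqrt_mul_sqrt_self _ (Matrix.nonneg_iff_posSemidef.2 hM.inv.posSemidef)

theorem norm_invSqrt_mulVec_sq {M : Matrix (Fin n) (Fin n) ℝ} (hM : M.PosDef) (u : E n) :
    ‖mulVec (invSqrt M) u‖ ^ 2 = quad M⁻¹ u := by
  rw [← real_inner_self_eq_norm_sq, inner_mulVec, (invSqrt_isSymm M).eq, ← mulVec_mul,
    invSqrt_mul_self hM, quad]

theorem mulVec_inv_mulVec {M : Matrix (Fin n) (Fin n) ℝ} (hM : M.PosDef) (u : E n) :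
    mulVec M⁻¹ (mulVec M u) = u := by
  rw [← mulVec_mul, Matrix.nonsing_inv_mul _ ((Matrix.isUnit_iff_isUnit_det _).1 hM.isUnit),
    mulVec_one]

theorem mulVec_mulVec_inv {M : Matrix (Fin n) (Fin n) ℝ} (hM : M.PosDef) (u : E n) :
    mulVec M (mulVec M⁻¹ u) = u := by
  rw [← mulVec_mul, Matrix.mul_nonsing_inv _ ((Matrix.isUnit_iff_isUnit_det _).1 hM.isUnit),
    mulVec_one]

/-- Every vector is the image of a vector of norm `‖u‖_M` under `M^{-1/2}`. -/
theorem exists_invSqrt_mulVec {M : Matrix (Fin n) (Fin n) ℝ} (hM : M.PosDef) (u : E n) :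
    ∃ w, mulVec (invSqrt M) w = u ∧ ‖w‖ ^ 2 = quad M u := by
  refine ⟨mulVec (invSqrt M) (mulVec M u), ?_, ?_⟩
  · rw [← mulVec_mul, invSqrt_mul_self hM, mulVec_inv_mulVec hM]
  · rw [norm_invSqrt_mulVec_sq hM, quad, mulVec_inv_mulVec hM, real_inner_comm, quad]

theorem norm_sq_le_quad {M : Matrix (Fin n) (Fin n) ℝ} (hM : M.PosDef) (u : E n) :
    ‖u‖ ^ 2 ≤ spectralNorm (invSqrt M) ^ 2 * quad M u := by
  obtain ⟨w, hw, hq⟩ := exists_invSqrt_mulVec hM u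
  rw [← hq, ← mul_pow, ← hw]
  exact pow_le_pow_left₀ (norm_nonneg _) (norm_mulVec_le _ _) 2

/-- Substituting u = A^{-1/2} w turns the spectral norm into a comparison of quadratic forms, the
shape in which the energy estimates use it. -/
theorem quad_inv_le {M₂ : Matrix (Fin m) (Fin m) ℝ} {A : Matrix (Fin n) (Fin n) ℝ}
    (hM₂ : M₂.PosDef) (hA : A.PosDef) (K : Matrix (Fin m) (Fin n) ℝ) (u : E n) :
    quad M₂⁻¹ (mulVec K u) ≤ spectralNorm (invSqrt M₂ * K * invSqrt A) ^ 2 * quad A u := by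
  obtain ⟨w, hw, hq⟩ := exists_invSqrt_mulVec hA u
  rw [← hq, ← mul_pow, ← norm_invSqrt_mulVec_sq hM₂, ← hw, ← mulVec_mul, ← mulVec_mul]
  exact pow_le_pow_left₀ (norm_nonneg _) (norm_mulVec_le _ _) 2

end Forms

/-! ### Subgradients from optimality and from the saddle point -/

section Convex

variable {m n : ℕ}

theorem subdiff_monotone {F : E n → EReal} (hF : ∀ x, F x ≠ ⊥) {x₁ x₂ ξ₁ ξ₂ : E n}
    (h₁ : ξ₁ ∈ subdiff F x₁) (h₂ : ξ₂ ∈ subdiff F x₂) : 0 ≤ ⟪x₁ - x₂, ξ₁ - ξ₂⟫_ℝ := by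
  have i₁ := h₁.2 x₂
  have i₂ := h₂.2 x₁
  lift F x₁ to ℝ using ⟨h₁.1.ne, hF x₁⟩ with p
  lift F x₂ to ℝ using ⟨h₂.1.ne, hF x₂⟩ with r
  norm_cast at i₁ i₂
  have : ⟪x₁ - x₂, ξ₁ - ξ₂⟫_ℝ = - ⟪ξ₁, x₂ - x₁⟫_ℝ - ⟪ξ₂, x₁ - x₂⟫_ℝ := by
    rw [real_inner_comm]
    simp only [inner_sub_left, inner_sub_right]; ring
  linarith

/-- First-order optimality for the sum of a convex function and a function which is quadratic
along lines through the minimizer. -/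
theorem neg_mem_subdiff_of_mem_argmin {F : E n → EReal} (hbot : ∀ x, F x ≠ ⊥)
    (hfin : ∃ x, F x ≠ ⊤) (hconv : Convex ℝ {p : E n × ℝ | F p.1 ≤ (p.2 : EReal)})
    {φ c : E n → ℝ} {x v : E n}
    (hφ : ∀ (t : ℝ) (u : E n), φ (x + t • u) = φ x + t * ⟪v, u⟫_ℝ + t ^ 2 * c u)
    (hx : x ∈ argmin (fun z => F z + (φ z : EReal))) : -v ∈ subdiff F x := by
  have hx' : ∀ z, F x + (φ x : EReal) ≤ F z + (φ z : EReal) := hx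
  have hxt : F x ≠ ⊤ := by
    intro h
    obtain ⟨z, hz⟩ := hfin
    have := hx' z
    lift F z to ℝ using ⟨hz, hbot z⟩ with r
    rw [h, EReal.top_add_coe, top_le_iff] at this
    exact EReal.coe_ne_top _ this
  refine ⟨lt_top_iff_ne_top.2 hxt, fun z => ?_⟩
  by_cases hz : F z = ⊤
  · rw [hz]; exact le_top
  obtain ⟨p, hp⟩ : ∃ p : ℝ, F x = p := ⟨_, (EReal.coe_toReal hxt (hbot x)).symm⟩
  obtain ⟨r, hr⟩ : ∃ r : ℝ, F z = r := ⟨_, (EReal.coe_toReal hz (hbot z)).symm⟩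
  -- Only F has to be convex on the segment: after division by t the quadratic term vanishes as t →
  -- 0⁺ whatever its sign, so an indefinite M₁ is admissible.
  have key : ∀ t : ℝ, 0 < t → t ≤ 1 → 0 ≤ (r - p + ⟪v, z - x⟫_ℝ) + t * c (z - x) := by
    intro t ht ht1
    have hmem := hconv (x := (x, p)) (by simp [hp]) (y := (z, r)) (by simp [hr])
      (sub_nonneg.2 ht1) ht.le (by ring)
    have hpt : (1 - t) • x + t • z = x + t • (z - x) := by module
    simp only [Set.mem_ofPred_eq, Prod.smul_mk, Prod.mk_add_mk, smul_eq_mul, hpt] at hmem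
    have h1 := (hx' (x + t • (z - x))).trans
      (add_le_add_left hmem ((φ (x + t • (z - x)) : ℝ) : EReal))
    rw [hp, hφ] at h1
    norm_cast at h1
    have : 0 ≤ t * ((r - p + ⟪v, z - x⟫_ℝ) + t * c (z - x)) := by linarith
    exact nonneg_of_mul_nonneg_right this ht
  have hlim : Tendsto (fun t : ℝ => (r - p + ⟪v, z - x⟫_ℝ) + t * c (z - x)) (𝓝[>] 0)
      (𝓝 (r - p + ⟪v, z - x⟫_ℝ)) := by
    have : Continuous fun t : ℝ => (r - p + ⟪v, z - x⟫_ℝ) + t * c (z - x) := by fun_prop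
    simpa using (this.tendsto 0).mono_left nhdsWithin_le_nhds
  have h0 : 0 ≤ r - p + ⟪v, z - x⟫_ℝ := by
    refine ge_of_tendsto hlim ?_
    filter_upwards [Ioc_mem_nhdsGT (zero_lt_one' ℝ)] with t ht using key t ht.1 ht.2
  rw [hp, hr, inner_neg_left]
  norm_cast
  linarith

theorem conj_ne_bot {g : E m → EReal} (hg : ProperClosedConvex g) (y : E m) : conj g y ≠ ⊥ := by
  obtain ⟨z, hz⟩ := hg.exists_ne_top
  obtain ⟨r, hr⟩ : ∃ r : ℝ, g z = r := ⟨_, (EReal.coe_toReal hz (hg.ne_bot z)).symm⟩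
  have h : ((⟪z, y⟫_ℝ : ℝ) : EReal) - g z ≤ conj g y :=
    le_iSup (fun z : E m => ((⟪z, y⟫_ℝ : ℝ) : EReal) - g z) z
  intro hb
  rw [hb, hr, le_bot_iff] at h
  norm_cast at h

/-- The epigraph of a supremum is the intersection of the epigraphs, here half-spaces, or the whole
space where g is infinite. -/
theorem convex_epigraph_conj {g : E m → EReal} (hg : ProperClosedConvex g) :
    Convex ℝ {p : E m × ℝ | conj g p.1 ≤ (p.2 : EReal)} := by
  have : {p : E m × ℝ | conj g p.1 ≤ (p.2 : EReal)}
      = ⋂ z : E m, {p : E m × ℝ | ((⟪z, p.1⟫_ℝ : ℝ) : EReal) - g z ≤ (p.2 : EReal)} := by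
    ext p; simp [conj, iSup_le_iff]
  rw [this]
  refine convex_iInter fun z => ?_
  by_cases hz : g z = ⊤
  · simp [hz, convex_univ]
  obtain ⟨r, hr⟩ : ∃ r : ℝ, g z = r := ⟨_, (EReal.coe_toReal hz (hg.ne_bot z)).symm⟩
  intro p hp q hq s t hs ht hst
  simp only [Set.mem_ofPred_eq, hr] at hp hq ⊢
  norm_cast at hp hq ⊢
  simp only [Prod.fst_add, Prod.snd_add, Prod.smul_fst, Prod.smul_snd, inner_add_right,
    inner_smul_right, smul_eq_mul]
  have : r = s * r + t * r := by rw [← add_mul, hst, one_mul]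
  nlinarith

theorem IsSaddlePoint.mem_subdiff_left {f : E n → EReal} {g : E m → EReal}
    {K : Matrix (Fin m) (Fin n) ℝ} {xs : E n} {ys : E m} (hf : ∀ x, f x ≠ ⊥)
    (hg : ∀ y, conj g y ≠ ⊥) (h : IsSaddlePoint f g K xs ys) :
    -mulVec K.transpose ys ∈ subdiff f xs := by
  obtain ⟨hx, hy, hL⟩ := h
  refine ⟨hx, fun z => ?_⟩
  by_cases hz : f z = ⊤
  · rw [hz]; exact le_top
  have h1 := (hL z ys).2
  simp only [saddleFun] at h1
  lift f xs to ℝ using ⟨hx.ne, hf xs⟩ with p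
  lift f z to ℝ using ⟨hz, hf z⟩ with r
  lift conj g ys to ℝ using ⟨hy.ne, hg ys⟩ with q
  norm_cast at h1 ⊢
  rw [inner_neg_left, real_inner_comm, ← inner_mulVec, mulVec_sub, inner_sub_left]
  linarith

theorem IsSaddlePoint.mem_subdiff_right {f : E n → EReal} {g : E m → EReal}
    {K : Matrix (Fin m) (Fin n) ℝ} {xs : E n} {ys : E m} (hf : ∀ x, f x ≠ ⊥)
    (hg : ∀ y, conj g y ≠ ⊥) (h : IsSaddlePoint f g K xs ys) :
    mulVec K xs ∈ subdiff (conj g) ys := by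
  obtain ⟨hx, hy, hL⟩ := h
  refine ⟨hy, fun z => ?_⟩
  by_cases hz : conj g z = ⊤
  · rw [hz]; exact le_top
  have h1 := (hL xs z).1
  simp only [saddleFun] at h1
  lift f xs to ℝ using ⟨hx.ne, hf xs⟩ with p
  lift conj g z to ℝ using ⟨hz, hg z⟩ with r
  lift conj g ys to ℝ using ⟨hy.ne, hg ys⟩ with q
  norm_cast at h1 ⊢
  rw [inner_sub_right]
  linarith

theorem Step.mem_subdiff_left {f : E n → EReal} {g : E m → EReal} {K : Matrix (Fin m) (Fin n) ℝ}
    {M₁ : Matrix (Fin n) (Fin n) ℝ} {M₂ : Matrix (Fin m) (Fin m) ℝ} {x x' : E n} {y y' : E m}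
    (hf : ProperClosedConvex f) (hM₁ : M₁.IsSymm) (h : Step f g K M₁ M₂ x y x' y') :
    -(mulVec K.transpose y + mulVec M₁ (x' - x)) ∈ subdiff f x' := by
  refine neg_mem_subdiff_of_mem_argmin hf.ne_bot hf.exists_ne_top hf.convex_epigraph
    (c := fun u => 1 / 2 * quad M₁ u) (fun t u => ?_) h.1
  have e : x' + t • u - x = (x' - x) + t • u := by abel
  rw [e, inner_add_left, real_inner_comm u (mulVec K.transpose y), ← inner_mulVec, ← bil_self,
    ← bil_self, ← bil_self, real_inner_comm u (mulVec M₁ _), ← bil_apply]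
  simp only [map_add, map_smul, LinearMap.add_apply, LinearMap.smul_apply, smul_eq_mul,
    mulVec_add, mulVec_smul, inner_add_left, inner_smul_left, conj_trivial]
  rw [bil_comm hM₁ (x' - x) u]
  ring

theorem Step.mem_subdiff_right {f : E n → EReal} {g : E m → EReal} {K : Matrix (Fin m) (Fin n) ℝ}
    {M₁ : Matrix (Fin n) (Fin n) ℝ} {M₂ : Matrix (Fin m) (Fin m) ℝ} {x x' : E n} {y y' : E m}
    (hg : ProperClosedConvex g) (hfin : ∃ w, conj g w ≠ ⊤) (hM₂ : M₂.IsSymm)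
    (h : Step f g K M₁ M₂ x y x' y') :
    mulVec K ((2 : ℝ) • x' - x) - mulVec M₂ (y' - y) ∈ subdiff (conj g) y' := by
  have := neg_mem_subdiff_of_mem_argmin (conj_ne_bot hg) hfin (convex_epigraph_conj hg)
    (v := -mulVec K ((2 : ℝ) • x' - x) + mulVec M₂ (y' - y))
    (c := fun u => 1 / 2 * quad M₂ u) (fun t u => ?_) h.2
  · convert this using 1; abel
  have e : y' + t • u - y = (y' - y) + t • u := by abel
  rw [e, inner_add_left, ← bil_self, ← bil_self, ← bil_self, real_inner_comm u (mulVec M₂ _),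
    ← bil_apply]
  simp only [map_add, map_smul, LinearMap.add_apply, LinearMap.smul_apply, smul_eq_mul,
    inner_add_right, inner_smul_right, inner_neg_left]
  rw [bil_comm hM₂ (y' - y) u]
  ring

end Convex
-- Residuals along the iteration
section Iterates

variable {m n : ℕ}

theorem kktResidual_le {f : E n → EReal} {g : E m → EReal} {K : Matrix (Fin m) (Fin n) ℝ}
    {x ξ : E n} {y η : E m} {c : ℝ} (hξ : ξ ∈ subdiff f x) (hη : η ∈ subdiff (conj g) y)
    (h₁ : ‖ξ + mulVec K.transpose y‖ ≤ c) (h₂ : ‖η - mulVec K x‖ ≤ c) :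
    kktResidual f g K x y ≤ ENNReal.ofReal c := by
  refine max_le ?_ ?_
  · refine (Metric.infEDist_le_edist_of_mem (Set.mem_image_of_mem _ hξ)).trans ?_
    rw [edist_dist, dist_zero_left]
    exact ENNReal.ofReal_le_ofReal h₁
  · refine (Metric.infEDist_le_edist_of_mem (Set.mem_image_of_mem _ hη)).trans ?_
    rw [edist_dist, dist_zero_left]
    exact ENNReal.ofReal_le_ofReal h₂

theorem add_add_le_sqrt {D p q r : ℝ} :
    D * (p + q + r) ≤ Real.sqrt (3 * D ^ 2 * (p ^ 2 + q ^ 2 + r ^ 2)) := by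
  refine Real.le_sqrt_of_sq_le ?_
  have : (p + q + r) ^ 2 ≤ 3 * (p ^ 2 + q ^ 2 + r ^ 2) := by
    nlinarith [sq_nonneg (p - q), sq_nonneg (q - r), sq_nonneg (p - r)]
  nlinarith [mul_le_mul_of_nonneg_left this (sq_nonneg D)]

/-- Both residuals along the iteration are controlled by the increments of the iterates. -/
theorem exists_kktResidual_le_increments {f : E n → EReal} {g : E m → EReal}
    {K : Matrix (Fin m) (Fin n) ℝ} {M₁ : Matrix (Fin n) (Fin n) ℝ} {M₂ : Matrix (Fin m) (Fin m) ℝ}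
    {x : ℕ → E n} {y : ℕ → E m}
    (hξ : ∀ k, -(mulVec K.transpose (y k) + mulVec M₁ (x (k + 1) - x k)) ∈ subdiff f (x (k + 1)))
    (hη : ∀ k, mulVec K ((2 : ℝ) • x (k + 1) - x k) - mulVec M₂ (y (k + 1) - y k) ∈
      subdiff (conj g) (y (k + 1))) :
    ∃ C : ℝ, 0 ≤ C ∧ ∀ k,
      kktResidual f g K (x (k + 1)) (y (k + 1)) ≤ ENNReal.ofReal (Real.sqrt
        (C * (‖x (k + 2) - x (k + 1)‖ ^ 2 + ‖x (k + 1) - x k‖ ^ 2 + ‖y (k + 1) - y k‖ ^ 2))) ∧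
      kktResidual f g K (x (k + 2)) (y (k + 1)) ≤ ENNReal.ofReal (Real.sqrt
        (C * (‖x (k + 2) - x (k + 1)‖ ^ 2 + ‖x (k + 1) - x k‖ ^ 2 + ‖y (k + 1) - y k‖ ^ 2))) := by
  set D : ℝ := spectralNorm K.transpose + spectralNorm M₁ + spectralNorm K + spectralNorm M₂
    with hD
  have n1 := spectralNorm_nonneg K.transpose
  have n2 := spectralNorm_nonneg M₁
  have n3 := spectralNorm_nonneg K
  have n4 := spectralNorm_nonneg M₂
  refine ⟨3 * D ^ 2, by positivity, fun k => ?_⟩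
  set d := x (k + 1) - x k with hd
  set d' := x (k + 2) - x (k + 1) with hd'
  set p := y (k + 1) - y k with hp
  have bK' : ‖mulVec K.transpose p‖ ≤ D * ‖p‖ := (norm_mulVec_le _ _).trans (by gcongr; linarith)
  have bM₁ : ‖mulVec M₁ d‖ ≤ D * ‖d‖ := (norm_mulVec_le _ _).trans (by gcongr; linarith)
  have bM₁' : ‖mulVec M₁ d'‖ ≤ D * ‖d'‖ := (norm_mulVec_le _ _).trans (by gcongr; linarith)
  have bK : ‖mulVec K d‖ ≤ D * ‖d‖ := (norm_mulVec_le _ _).trans (by gcongr; linarith)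
  have bKd : ‖mulVec K d'‖ ≤ D * ‖d'‖ := (norm_mulVec_le _ _).trans (by gcongr; linarith)
  have bM₂ : ‖mulVec M₂ p‖ ≤ D * ‖p‖ := (norm_mulVec_le _ _).trans (by gcongr; linarith)
  have z1 : 0 ≤ D * ‖d'‖ := (norm_nonneg _).trans bKd
  have z2 : 0 ≤ D * ‖d‖ := (norm_nonneg _).trans bK
  have z3 : 0 ≤ D * ‖p‖ := (norm_nonneg _).trans bM₂
  constructor
  · refine (kktResidual_le (hξ k) (hη k) (c := D * (‖d'‖ + ‖d‖ + ‖p‖)) ?_ ?_).trans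
      (ENNReal.ofReal_le_ofReal add_add_le_sqrt)
    · have : -(mulVec K.transpose (y k) + mulVec M₁ d) + mulVec K.transpose (y (k + 1))
          = mulVec K.transpose p - mulVec M₁ d := by simp only [hp, mulVec_sub]; abel
      rw [this]
      linarith [norm_sub_le (mulVec K.transpose p) (mulVec M₁ d)]
    · have : mulVec K ((2 : ℝ) • x (k + 1) - x k) - mulVec M₂ p - mulVec K (x (k + 1))
          = mulVec K d - mulVec M₂ p := by
        simp only [hd, mulVec_sub, mulVec_add, two_smul]; abel
      rw [this]
      linarith [norm_sub_le (mulVec K d) (mulVec M₂ p)]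
  -- The mixed residual pairs the primal subgradient of the next step with the dual one of the
  -- current step, hence the second primal increment d'.
  · refine (kktResidual_le (hξ (k + 1)) (hη k) (c := D * (‖d'‖ + ‖d‖ + ‖p‖)) ?_ ?_).trans
      (ENNReal.ofReal_le_ofReal add_add_le_sqrt)
    · have : -(mulVec K.transpose (y (k + 1)) + mulVec M₁ d') + mulVec K.transpose (y (k + 1))
          = - mulVec M₁ d' := by abel
      rw [this, norm_neg]
      linarith
    · have : mulVec K ((2 : ℝ) • x (k + 1) - x k) - mulVec M₂ p - mulVec K (x (k + 2))
          = mulVec K d - mulVec K d' - mulVec M₂ p := by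
        simp only [hd, hd', mulVec_sub, mulVec_add, two_smul]; abel
      rw [this]
      linarith [norm_sub_le (mulVec K d - mulVec K d') (mulVec M₂ p),
        norm_sub_le (mulVec K d) (mulVec K d')]

/-- With J = M₂⁻¹K the coupling becomes an M₂-inner product, as the abstract energy lemmas require.
-/
theorem bil_precond_right {M₂ : Matrix (Fin m) (Fin m) ℝ} (hM₂ : M₂.PosDef)
    (K : Matrix (Fin m) (Fin n) ℝ) (w : E m) (u : E n) :
    bil M₂ w (mulVecLin (M₂⁻¹ * K) u) = ⟪w, mulVec K u⟫_ℝ := by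
  rw [bil_apply]
  change ⟪w, mulVec M₂ (mulVec (M₂⁻¹ * K) u)⟫_ℝ = _
  rw [mulVec_mul, mulVec_mulVec_inv hM₂]

theorem inner_neg_add_sub (K : Matrix (Fin m) (Fin n) ℝ) (y y' : E m) (u u' v : E n) :
    ⟪-(mulVec K.transpose y + u) - -(mulVec K.transpose y' + u'), v⟫_ℝ
      = -⟪y - y', mulVec K v⟫_ℝ - ⟪v, u - u'⟫_ℝ := by
  have h : -(mulVec K.transpose y + u) - -(mulVec K.transpose y' + u')
      = -(mulVec K.transpose (y - y')) - (u - u') := by rw [mulVec_sub]; abel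
  rw [h, inner_sub_left, inner_neg_left, real_inner_comm v (u - u'), inner_mulVec,
    Matrix.transpose_transpose]

end Iterates
end PrePDHG

/-! ### The theorem -/

open PrePDHG in
theorem theorem3p2 {m n : ℕ}
    (f : PrePDHG.E n → EReal) (g : PrePDHG.E m → EReal) (K : Matrix (Fin m) (Fin n) ℝ)
    (hf : PrePDHG.ProperClosedConvex f) (hg : PrePDHG.ProperClosedConvex g)
    (hsaddle : ∃ xs ys, PrePDHG.IsSaddlePoint f g K xs ys)
    (Sf : Matrix (Fin n) (Fin n) ℝ) (hSf : PrePDHG.IsMonotonicityModulus f Sf)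
    (M₁ : Matrix (Fin n) (Fin n) ℝ) (M₂ : Matrix (Fin m) (Fin m) ℝ) (hM₁symm : M₁.IsSymm)
    (hM₁ : (M₁ + (1 / 2 : ℝ) • Sf).PosDef) (hM₂ : M₂.PosDef)
    (x : ℕ → PrePDHG.E n) (y : ℕ → PrePDHG.E m)
    (hxy : PrePDHG.IsIterates f g K M₁ M₂ x y) :
    (PrePDHG.spectralNorm
        (PrePDHG.invSqrt M₂ * K * PrePDHG.invSqrt (M₁ + (1 / 2 : ℝ) • Sf)) ^ 2 < 4 / 3 →
      PrePDHG.IsLittleOInvSqrt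
        (fun t => ⨅ k ∈ Finset.Icc 1 t, PrePDHG.kktResidual f g K (x k) (y k)) ∧
      PrePDHG.IsLittleOInvSqrt
        (fun t => ⨅ k ∈ Finset.Icc 1 t, PrePDHG.kktResidual f g K (x k) (y (k - 1)))) ∧
    (PrePDHG.spectralNorm
        (PrePDHG.invSqrt M₂ * K * PrePDHG.invSqrt (M₁ + (1 / 2 : ℝ) • Sf)) < 1 →
      PrePDHG.IsLittleOInvSqrt (fun t => PrePDHG.kktResidual f g K (x t) (y t)) ∧
      PrePDHG.IsLittleOInvSqrt (fun t => PrePDHG.kktResidual f g K (x t) (y (t - 1)))) := by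
  obtain ⟨xs, ys, hsad⟩ := hsaddle
  have hM₂symm : M₂.IsSymm := by
    simpa [Matrix.IsHermitian, Matrix.IsSymm] using hM₂.isHermitian
  have hgb := conj_ne_bot hg
  have hξ := fun k => (hxy k).mem_subdiff_left hf hM₁symm
  have hη := fun k => (hxy k).mem_subdiff_right hg ⟨ys, hsad.2.1.ne⟩ hM₂symm
  -- The zero stands for the absent proximal term, so that `inner_neg_add_sub` covers the saddle
  -- point too.
  have hξs : -(mulVec K.transpose ys + 0) ∈ subdiff f xs := by
    rw [add_zero]; exact hsad.mem_subdiff_left hf.ne_bot hgb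
  have hηs := hsad.mem_subdiff_right hf.ne_bot hgb
  obtain ⟨C, hC, hR⟩ := exists_kktResidual_le_increments hξ hη
  set A := M₁ + (1 / 2 : ℝ) • Sf with hAdef
  set q := spectralNorm (invSqrt M₂ * K * invSqrt A) with hqdef
  have hq0 : 0 ≤ q := spectralNorm_nonneg _
  set J := mulVecLin (M₂⁻¹ * K) with hJ
  have hb := bil_comm hM₂symm
  have hJr : ∀ w u, bil M₂ w (J u) = ⟪w, mulVec K u⟫_ℝ := bil_precond_right hM₂ K
  have hA : ∀ u, bil M₁ u u + 1 / 2 * bil Sf u u = quad A u := fun u => by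
    rw [hAdef, quad_add_half_smul, bil_self, bil_self]
  have hA0 : ∀ u, 0 ≤ bil M₁ u u + 1 / 2 * bil Sf u u := fun u => by
    rw [hA]; exact quad_nonneg hM₁.posSemidef u
  have hs0 : ∀ u, 0 ≤ bil Sf u u := quad_nonneg hSf.1
  have hb0 : ∀ u, 0 ≤ bil M₂ u u := quad_nonneg hM₂.posSemidef
  have hq : ∀ u, bil M₂ (J u) (J u) ≤ q ^ 2 * (bil M₁ u u + 1 / 2 * bil Sf u u) := fun u => by
    rw [hA]
    refine le_trans (le_of_eq ?_) (quad_inv_le hM₂ hM₁ K u)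
    rw [hJr, real_inner_comm, quad, ← mulVec_mul]; rfl
  have h1 : ∀ k, bil Sf (x (k + 1) - xs) (x (k + 1) - xs) ≤
      - bil M₂ (J (x (k + 1) - xs)) (y k - ys) - bil M₁ (x (k + 1) - xs) (x (k + 1) - x k) := by
    intro k
    have := hSf.2 _ _ _ _ (hξ k) hξs
    rwa [inner_neg_add_sub, sub_zero, ← hJr, hb] at this
  have h3 : ∀ k, bil Sf (x (k + 2) - x (k + 1)) (x (k + 2) - x (k + 1)) ≤
      - bil M₂ (J (x (k + 2) - x (k + 1))) (y (k + 1) - y k)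
        - bil M₁ (x (k + 2) - x (k + 1)) (x (k + 2) - x (k + 1) - (x (k + 1) - x k)) := by
    intro k
    have := hSf.2 _ _ _ _ (hξ (k + 1)) (hξ k)
    rwa [inner_neg_add_sub, ← mulVec_sub, ← hJr, hb] at this
  have h2 : ∀ k, 0 ≤ bil M₂ (y (k + 1) - ys)
      (J (x (k + 1) + x (k + 1) - x k - xs) - (y (k + 1) - y k)) := by
    intro k
    have := subdiff_monotone hgb (hη k) hηs
    rw [map_sub, hJr, mulVec_sub, bil_apply, ← inner_sub_right]
    convert this using 2
    rw [two_smul]; abel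
  have h4 : ∀ k, 0 ≤ bil M₂ (y (k + 2) - y (k + 1))
      (J (x (k + 2) - x (k + 1) + (x (k + 2) - x (k + 1)) - (x (k + 1) - x k))
        - (y (k + 2) - y (k + 1) - (y (k + 1) - y k))) := by
    intro k
    have := subdiff_monotone hgb (hη (k + 1)) (hη k)
    rw [map_sub, hJr, bil_apply, ← inner_sub_right]
    convert this using 2
    simp only [two_smul, mulVec_sub, mulVec_add]; abel
  set α := spectralNorm (invSqrt A) ^ 2
  set β := spectralNorm (invSqrt M₂) ^ 2
  have hα : ∀ u, ‖u‖ ^ 2 ≤ α * (bil M₁ u u + 1 / 2 * bil Sf u u) := fun u => by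
    rw [hA]; exact norm_sq_le_quad hM₁ u
  have hβ : ∀ u, ‖u‖ ^ 2 ≤ β * bil M₂ u u := norm_sq_le_quad hM₂
  have hsum := fun h : q ^ 2 < 4 / 3 => summable_increments (bil M₁) (bil Sf) (bil M₂) J
    (bil_comm hM₁symm) hb hs0 hb0 hA0 h hq x y xs ys h1 h2 h3
  have hsumx : q ^ 2 < 4 / 3 → Summable fun k => ‖x (k + 1) - x k‖ ^ 2 := fun h =>
    ((hsum h).1.mul_left α).of_nonneg_of_le (fun _ => by positivity) fun _ => hα _
  have hsumy : q ^ 2 < 4 / 3 → Summable fun k => ‖y (k + 1) - y k‖ ^ 2 := fun h =>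
    ((hsum h).2.mul_left β).of_nonneg_of_le (fun _ => by positivity) fun _ => hβ _
  refine ⟨fun h => ?_, fun h => ?_⟩
  · have hr : Summable fun k => C * (‖x (k + 2) - x (k + 1)‖ ^ 2 + ‖x (k + 1) - x k‖ ^ 2
        + ‖y (k + 1) - y k‖ ^ 2) :=
      ((((summable_nat_add_iff 1).2 (hsumx h)).add (hsumx h)).add (hsumy h)).mul_left C
    -- The shifts are 1 and 2: R(x¹, y⁰) may be infinite and is not bounded, which is harmless
    -- inside a minimum.
    exact ⟨isLittleOInvSqrt_iInf (fun _ => by positivity) hr le_rfl fun k => (hR k).1,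
      isLittleOInvSqrt_iInf (fun _ => by positivity) hr one_le_two fun k => (hR k).2⟩
  · have hq1 : q ^ 2 < 1 := by nlinarith
    have hq43 : q ^ 2 < 4 / 3 := by linarith
    set e : ℕ → ℝ := fun k => bil M₁ (x (k + 1) - x k) (x (k + 1) - x k)
      + bil Sf (x (k + 1) - x k) (x (k + 1) - x k)
      - 2 * bil M₂ (J (x (k + 1) - x k)) (y (k + 1) - y k)
      + bil M₂ (y (k + 1) - y k) (y (k + 1) - y k) with he
    have hcoer : ∀ u r, (1 - q ^ 2) / 2 * (bil M₁ u u + 1 / 2 * bil Sf u u + bil M₂ r r) ≤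
        bil M₁ u u + 1 / 2 * bil Sf u u - 2 * bil M₂ (J u) r + bil M₂ r r :=
      fun u r => block_coercive (bil M₁ + (1 / 2 : ℝ) • bil Sf) (bil M₂) J hb hb0 (sq_nonneg q)
        hq hA0 u r
    have hc : 0 < (1 - q ^ 2) / 2 := by linarith
    have hanti : Antitone e := antitone_nat_of_succ_le fun k =>
      increment_antitone (bil M₁) (bil Sf) (bil M₂) J (bil_comm hM₁symm) hb hs0
        (fun u r => (mul_nonneg hc.le (add_nonneg (hA0 u) (hb0 r))).trans (hcoer u r))
        _ _ _ _ (h3 k) (h4 k)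
    have hbound : ∀ k, ‖x (k + 1) - x k‖ ^ 2 + ‖y (k + 1) - y k‖ ^ 2 ≤
        (α + β) / ((1 - q ^ 2) / 2) * e k := by
      intro k
      have i1 := hcoer (x (k + 1) - x k) (y (k + 1) - y k)
      have i2 := hs0 (x (k + 1) - x k)
      have i3 := hA0 (x (k + 1) - x k)
      have i4 := hb0 (y (k + 1) - y k)
      have i5 : 0 ≤ α := sq_nonneg _
      have i6 : 0 ≤ β := sq_nonneg _
      have i7 : (1 - q ^ 2) / 2 * (bil M₁ (x (k + 1) - x k) (x (k + 1) - x k)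
          + 1 / 2 * bil Sf (x (k + 1) - x k) (x (k + 1) - x k)
          + bil M₂ (y (k + 1) - y k) (y (k + 1) - y k)) ≤ e k := by
        simp only [he]; linarith
      rw [mul_comm, ← le_div_iff₀ hc] at i7
      refine le_trans ?_ ((mul_le_mul_of_nonneg_left i7 (add_nonneg i5 i6)).trans_eq (by ring))
      nlinarith [hα (x (k + 1) - x k), hβ (y (k + 1) - y k), mul_nonneg i5 i4, mul_nonneg i6 i3]
    set γ := (α + β) / ((1 - q ^ 2) / 2) with hγ
    have hγ0 : 0 ≤ γ := div_nonneg (add_nonneg (sq_nonneg _) (sq_nonneg _)) hc.le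
    have he0 : ∀ k, 0 ≤ e k := fun k => by
      have := (mul_nonneg hc.le (add_nonneg (hA0 (x (k + 1) - x k))
        (hb0 (y (k + 1) - y k)))).trans (hcoer (x (k + 1) - x k) (y (k + 1) - y k))
      have := hs0 (x (k + 1) - x k)
      simp only [he]; linarith
    -- `e` carries the full Σ_f, the summable forms only half of it; the other half is bounded by
    -- the squared Euclidean norm.
    have hes : Summable e := by
      refine Summable.of_nonneg_of_le he0 (fun k => ?_)
        ((((hsum hq43).1.mul_left (1 + q ^ 2)).add
          ((hsumx hq43).mul_left (1 / 2 * spectralNorm Sf))).add ((hsum hq43).2.mul_left 2))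
      have i1 := hb0 (J (x (k + 1) - x k) + (y (k + 1) - y k))
      simp only [map_add, LinearMap.add_apply] at i1
      rw [hb (y (k + 1) - y k) (J (x (k + 1) - x k))] at i1
      have i2 := hq (x (k + 1) - x k)
      have i3 := quad_le Sf (x (k + 1) - x k)
      rw [← bil_self] at i3
      simp only [he]; linarith
    -- The factor 2 absorbs the later increment, since e (k + 1) ≤ e k.
    have hbd : ∀ k, C * (‖x (k + 2) - x (k + 1)‖ ^ 2 + ‖x (k + 1) - x k‖ ^ 2
        + ‖y (k + 1) - y k‖ ^ 2) ≤ C * (2 * γ) * e k := by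
      intro k
      have i1 := hbound k
      have i2 := hbound (k + 1)
      have i3 := mul_le_mul_of_nonneg_left (hanti (Nat.le_succ k)) hγ0
      have i4 := sq_nonneg ‖y (k + 2) - y (k + 1)‖
      rw [mul_assoc]
      refine mul_le_mul_of_nonneg_left ?_ hC
      linarith
    have hr : Antitone fun k => C * (2 * γ) * e k := fun i j hij =>
      mul_le_mul_of_nonneg_left (hanti hij) (by positivity)
    have hr0 : ∀ k, 0 ≤ C * (2 * γ) * e k := fun k => mul_nonneg (by positivity) (he0 k)
    have hmono := fun k => ENNReal.ofReal_le_ofReal (Real.sqrt_le_sqrt (hbd k))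
    exact ⟨isLittleOInvSqrt_of_antitone hr hr0 (hes.mul_left _) 1 fun k => (hR k).1.trans (hmono k),
      isLittleOInvSqrt_of_antitone hr hr0 (hes.mul_left _) 2 fun k => (hR k).2.trans (hmono k)⟩
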